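/- Let $(V,g)$ be an $n$-dimensional Euclidean vector space and let $\mathcal D=\Lambda V^*\otimes\Lambda V^*$ be the algebra of double forms, with product $(\theta_1\otimes\theta_2)(\theta_3\otimes\theta_4)=(\theta_1\wedge\theta_3)\otimes(\theta_2\wedge\theta_4)$, bigraded by $\mathcal D^{p,q}=\Lambda^pV^*\otimes\Lambda^qV^*$. An element of $\mathcal D^{p,q}$, called a $(p,q)$ double form, is also viewed as a bilinear form on $\Lambda^pV\times\Lambda^qV$. Let $\langle\theta_1\otimes\theta_2,\theta_3\otimes\theta_4\rangle=\langle\theta_1,\theta_3\rangle\langle\theta_2,\theta_4\rangle$ be the inner product of $\mathcal D$ induced by $g$, and $|\omega|^2=\langle\omega,\omega\rangle$. For an orthonormal basis $(e_i)$ of $V$ let $c:\mathcal D^{p,q}\to\mathcal D^{p-1,q-1}$ be the contraction $c\,\omega(x_1\wedge\dots\wedge x_{p-1},y_1\wedge\dots\wedge y_{q-1})=\sum_{i=1}^n\omega(e_i\wedge x_1\wedge\dots\wedge x_{p-1},e_i\wedge y_1\wedge\dots\wedge y_{q-1})$ (zero if $p=0$ or $q=0$), and let $*:\mathcal D^{p,q}\to\mathcal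 D^{n-p,n-q}$ be the double Hodge star operator $*(\theta_1\otimes\theta_2)=*\theta_1\otimes*\theta_2$. Let $R\in\mathcal D^{2,2}$ be symmetric, $R(u,v)=R(v,u)$, and satisfy the first Bianchi identity $$R(x_2\wedge x_3,x_1\wedge y)-R(x_1\wedge x_3,x_2\wedge y)+R(x_1\wedge x_2,x_3\wedge y)=0\qquad(x_1,x_2,x_3,y\in V).$$ For $0\le 2k\le n$ let $$h_{2k}(R)=\frac{1}{(n-2k)!}*\bigl(g^{n-2k}R^k\bigr)\in\mathcal D^{0,0}=\mathbb R$$ be its Gauss–Bonnet curvatures, where $g$ is regarded as a $(1,1)$ double form and the powers are taken in $\mathcal D$. Then, for every positive integer $q$ with $n\ge 4q$, $$h_{4q}(R)=\sum_{r=0}^{2q}\frac{(-1)^r}{(r!)^2}\,|c^rR^q|^2 .$$ In particular, if $n\ge 4$, $$h_4(R)=|R|^2-|cR|^2+\tfrac14|c^2R|^2,$$ and, if $n\ge 8$, $$h_8(R)=|R^2|^2-|cR^2|^2+\tfrac14|c^2R^2|^2-\tfrac1{36}|c^3R^2|^2+\tfrac1{576}|c^4R^2|^2 .$$ -/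

import Mathlib

open scoped TensorProduct

noncomputable section

namespace DoubleForms

section Algebra

variable (V : Type*) [AddCommGroup V] [Module ℝ V]

/-- The exterior algebra `Λ V*` of the dual space. -/
abbrev Forms : Type _ := ExteriorAlgebra ℝ (Module.Dual ℝ V)

/-- The algebra of double forms `D = Λ V* ⊗ Λ V*`. Its multiplication is that of the (ungraded)
tensor product of algebras: `(θ₁ ⊗ θ₂) (θ₃ ⊗ θ₄) = (θ₁ ∧ θ₃) ⊗ (θ₂ ∧ θ₄)`. -/
abbrev DoubleForm : Type _ := Forms V ⊗[ℝ] Forms V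

/-- The space `D^{p,q} = Λ^p V* ⊗ Λ^q V*` of `(p,q)` double forms, inside `D`. -/
def bidegree (p q : ℕ) : Submodule ℝ (DoubleForm V) :=
  LinearMap.range (TensorProduct.map
    (⋀[ℝ]^p (Module.Dual ℝ V)).subtype (⋀[ℝ]^q (Module.Dual ℝ V)).subtype)

variable {V}

/-- The determinant `(φ₁, …, φ_p) ↦ det (φ_i (x_j))`, as an alternating map on covectors. -/
def detEval {p : ℕ} (x : Fin p → V) : Module.Dual ℝ V [⋀^Fin p]→ₗ[ℝ] ℝ :=
  Matrix.detRowAlternating.compLinearMap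
    (LinearMap.pi fun j : Fin p => Module.Dual.eval ℝ V (x j))

/-- The value `θ (x₁ ∧ ⋯ ∧ x_p)` of a form, where
`(φ₁ ∧ ⋯ ∧ φ_p) (x₁ ∧ ⋯ ∧ x_p) = det (φ_i (x_j))`; the components of `θ` of degree other
than `p` do not contribute. -/
def evalForm {p : ℕ} (x : Fin p → V) : Forms V →ₗ[ℝ] ℝ :=
  ExteriorAlgebra.liftAlternating (Pi.single p (detEval x))

theorem evalForm_ιMulti {p : ℕ} (x : Fin p → V) (φ : Fin p → Module.Dual ℝ V) :
    evalForm x (ExteriorAlgebra.ιMulti ℝ p φ) = (Matrix.of fun i j => φ i (x j)).det := by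
  rw [evalForm, ExteriorAlgebra.liftAlternating_apply_ιMulti, Pi.single_eq_same]
  rfl

theorem evalForm_ιMulti_of_ne {p k : ℕ} (h : k ≠ p) (x : Fin p → V)
    (φ : Fin k → Module.Dual ℝ V) : evalForm x (ExteriorAlgebra.ιMulti ℝ k φ) = 0 := by
  rw [evalForm, ExteriorAlgebra.liftAlternating_apply_ιMulti, Pi.single_eq_of_ne h]
  rfl

theorem evalForm_update_add {p : ℕ} [inst : DecidableEq (Fin p)] (x : Fin p → V) (i : Fin p)
    (a b : V) :
    evalForm (Function.update x i (a + b)) =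
      evalForm (Function.update x i a) + evalForm (Function.update x i b) := by
  obtain rfl := Subsingleton.elim inst (instDecidableEqFin p)
  ext k φ
  simp only [LinearMap.compAlternatingMap_apply, LinearMap.add_apply]
  by_cases h : k = p
  · subst h
    simp only [evalForm_ιMulti]
    have key : ∀ c, (Matrix.of fun r j => φ r (Function.update x i c j)) =
        (Matrix.of fun r j => φ r (x j)).updateCol i fun r => φ r c := fun c => by
      ext r j
      by_cases hj : j = i
      · subst hj; simp
      · simp [hj]
    simp only [key, map_add]
    exact Matrix.det_updateCol_add (Matrix.of fun r j => φ r (x j)) i _ _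
  · simp [evalForm_ιMulti_of_ne h]

theorem evalForm_update_smul {p : ℕ} [inst : DecidableEq (Fin p)] (x : Fin p → V) (i : Fin p)
    (c : ℝ) (a : V) :
    evalForm (Function.update x i (c • a)) = c • evalForm (Function.update x i a) := by
  obtain rfl := Subsingleton.elim inst (instDecidableEqFin p)
  ext k φ
  simp only [LinearMap.compAlternatingMap_apply, LinearMap.smul_apply]
  by_cases h : k = p
  · subst h
    simp only [evalForm_ιMulti]
    have key : ∀ c, (Matrix.of fun r j => φ r (Function.update x i c j)) =
        (Matrix.of fun r j => φ r (x j)).updateCol i fun r => φ r c := fun c => by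
      ext r j
      by_cases hj : j = i
      · subst hj; simp
      · simp [hj]
    simp only [key, map_smul]
    exact Matrix.det_updateCol_smul (Matrix.of fun r j => φ r (x j)) i c _
  · simp [evalForm_ιMulti_of_ne h]

theorem evalForm_eq_zero_of_eq {p : ℕ} (x : Fin p → V) {i j : Fin p} (hij : i ≠ j)
    (h : x i = x j) : evalForm x = 0 := by
  ext k φ
  simp only [LinearMap.compAlternatingMap_apply, LinearMap.zero_apply]
  by_cases hk : k = p
  · subst hk
    rw [evalForm_ιMulti]
    exact Matrix.det_zero_of_column_eq hij (by simp [h])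
  · exact evalForm_ιMulti_of_ne hk x φ

/-- The value `ω (x₁ ∧ ⋯ ∧ x_p, y₁ ∧ ⋯ ∧ y_q)` of a double form seen as a bilinear form. -/
def eval {p q : ℕ} (x : Fin p → V) (y : Fin q → V) : DoubleForm V →ₗ[ℝ] ℝ :=
  LinearMap.mul' ℝ ℝ ∘ₗ TensorProduct.map (evalForm x) (evalForm y)

/-- The transpose of a double form, `(θ₁ ⊗ θ₂)ᵗ = θ₂ ⊗ θ₁`. -/
def transpose : DoubleForm V →ₗ[ℝ] DoubleForm V :=
  (TensorProduct.comm ℝ (Forms V) (Forms V)).toLinearMap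

/-- A double form is symmetric if it equals its transpose. -/
def IsSymmetric (ω : DoubleForm V) : Prop := transpose ω = ω

/-- The first Bianchi identity for a `(p, q + 1)` double form:
`∑ⱼ (-1)ʲ ω (x₀ ∧ ⋯ ∧ x̂ⱼ ∧ ⋯ ∧ x_p, xⱼ ∧ y₁ ∧ ⋯ ∧ y_q) = 0`. -/
def FirstBianchi (p q : ℕ) (ω : DoubleForm V) : Prop :=
  ∀ (x : Fin (p + 1) → V) (y : Fin q → V),
    ∑ j : Fin (p + 1),
      (-1 : ℝ) ^ (j : ℕ) * eval (fun i => x (j.succAbove i)) (Fin.cons (x j) y) ω = 0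

/-- Interior product of a form with a vector, `(i_v θ) (x₂ ∧ ⋯ ∧ x_p) = θ (v ∧ x₂ ∧ ⋯ ∧ x_p)`:
the antiderivation of `Λ V*` with `i_v φ = φ v`. -/
def interior (v : V) : Forms V →ₗ[ℝ] Forms V :=
  CliffordAlgebra.contractLeft (Q := (0 : QuadraticForm ℝ (Module.Dual ℝ V)))
    (Module.Dual.eval ℝ V v)

end Algebra

section Euclidean

variable {V : Type*} [NormedAddCommGroup V] [InnerProductSpace ℝ V]

/-- The vector `φ♯` dual to a covector: `⟪φ♯, v⟫ = φ v`. -/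
def sharp [FiniteDimensional ℝ V] : Module.Dual ℝ V →ₗ[ℝ] V where
  toFun φ := (InnerProductSpace.toDual ℝ V).symm (LinearMap.toContinuousLinearMap φ)
  map_add' φ ψ := by simp
  map_smul' c φ := by simp

/-- The alternating map `(φ₁, …, φ_p) ↦ (θ ↦ θ (φ₁♯ ∧ ⋯ ∧ φ_p♯))`. -/
def pairing [FiniteDimensional ℝ V] (p : ℕ) :
    Module.Dual ℝ V [⋀^Fin p]→ₗ[ℝ] (Forms V →ₗ[ℝ] ℝ) where
  toFun φ := evalForm fun i => sharp (φ i)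
  map_update_add' := fun φ i a b => by
    have key : ∀ c, (fun j => sharp (Function.update φ i c j)) =
        Function.update (fun j => sharp (φ j)) i (sharp c) := fun c =>
      funext fun j => Function.apply_update (fun _ => sharp) φ i c j
    simp only [key, map_add, evalForm_update_add]
  map_update_smul' := fun φ i c a => by
    have key : ∀ c, (fun j => sharp (Function.update φ i c j)) =
        Function.update (fun j => sharp (φ j)) i (sharp c) := fun c =>
      funext fun j => Function.apply_update (fun _ => sharp) φ i c j
    simp only [key, map_smul, evalForm_update_smul]
  map_eq_zero_of_eq' φ i j h hij :=
    evalForm_eq_zero_of_eq _ hij (congrArg sharp h)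

/-- The inner product of `Λ V*`: forms of different degrees are orthogonal, and
`⟨φ₁ ∧ ⋯ ∧ φ_p, ψ₁ ∧ ⋯ ∧ ψ_p⟩ = det ⟨φ_i, ψ_j⟩`. -/
def formInner [FiniteDimensional ℝ V] : LinearMap.BilinForm ℝ (Forms V) :=
  ExteriorAlgebra.liftAlternating fun p => pairing p

/-- The inner product of double forms, `⟨θ₁ ⊗ θ₂, θ₃ ⊗ θ₄⟩ = ⟨θ₁, θ₃⟩ ⟨θ₂, θ₄⟩`. -/
def dfInner [FiniteDimensional ℝ V] : LinearMap.BilinForm ℝ (DoubleForm V) :=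
  LinearMap.BilinForm.tmul formInner formInner

/-- The squared norm `|ω|² = ⟨ω, ω⟩` of a double form. -/
def normSq [FiniteDimensional ℝ V] (ω : DoubleForm V) : ℝ := dfInner ω ω

variable {n : ℕ} (e : OrthonormalBasis (Fin n) ℝ V)

/-- The covectors `e¹, …, eⁿ` dual to an orthonormal basis. -/
def coframe (i : Fin n) : Module.Dual ℝ V := innerₗ V (e i)

/-- The form `e^I = e^{i₁} ∧ ⋯ ∧ e^{i_p}`, where `I = {i₁ < ⋯ < i_p}`. -/
def basisForm (I : Finset (Fin n)) : Forms V :=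
  ExteriorAlgebra.ιMulti ℝ I.card fun i => coframe e (I.orderEmbOfFin rfl i)

/-- The inner product `g` of `V` as a `(1,1)` double form, `g = ∑ᵢ eⁱ ⊗ eⁱ`. -/
def metric : DoubleForm V :=
  ∑ i, ExteriorAlgebra.ι ℝ (coframe e i) ⊗ₜ[ℝ] ExteriorAlgebra.ι ℝ (coframe e i)

/-- The contraction map of double forms,
`c ω (x₁ ∧ ⋯, y₁ ∧ ⋯) = ∑ᵢ ω (eᵢ ∧ x₁ ∧ ⋯, eᵢ ∧ y₁ ∧ ⋯)`; it vanishes on `D^{p,0}` and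
`D^{0,q}`. -/
def contraction : DoubleForm V →ₗ[ℝ] DoubleForm V :=
  ∑ i, TensorProduct.map (interior (e i)) (interior (e i))

/-- The Hodge star operator of `Λ V*`, for the volume form `vol = e¹ ∧ ⋯ ∧ eⁿ`:
`⟨*β, γ⟩ = ⟨β ∧ γ, vol⟩`, that is, `*β = ∑_I ⟨β ∧ e^I, vol⟩ e^I`. -/
def hodge [FiniteDimensional ℝ V] : Forms V →ₗ[ℝ] Forms V :=
  ∑ I : Finset (Fin n),
    ((formInner (basisForm e Finset.univ)) ∘ₗ
      LinearMap.mulRight ℝ (basisForm e I)).smulRight (basisForm e I)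

/-- The double Hodge star operator `*(θ₁ ⊗ θ₂) = *θ₁ ⊗ *θ₂`. For a `(p,q)` double form seen as a
bilinear form this is `(*ω)(u, v) = (-1)^{(p+q)(n-p-q)} ω (*u, *v)`, because
`θ (*u) = (-1)^{p(n-p)} (*θ) u` for `θ` of degree `p`. -/
def doubleHodge [FiniteDimensional ℝ V] : DoubleForm V →ₗ[ℝ] DoubleForm V :=
  TensorProduct.map (hodge e) (hodge e)

/-- The Gauss–Bonnet curvature `h_{2k}(R) = (1/(n-2k)!) *(g^{n-2k} R^k)`, for `2k ≤ n` and a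
`(2,2)` double form `R`. The right-hand side is a `(0,0)` double form, identified with a real
number by evaluating it on no vectors. -/
def gaussBonnet [FiniteDimensional ℝ V] (k : ℕ) (R : DoubleForm V) : ℝ :=
  (1 / ((n - 2 * k).factorial : ℝ)) *
    eval (Fin.elim0 : Fin 0 → V) (Fin.elim0 : Fin 0 → V)
      (doubleHodge e (metric e ^ (n - 2 * k) * R ^ k))

end Euclidean

end DoubleForms

end

/-! The proof is representation theory of `sl₂`. Multiplication by the metric `g` and the
contraction `c` are adjoint and nilpotent, and `H = [c, g]` acts on a product of `p` squares `φ ⊗ φ`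
as the scalar `n - 2p`. For a covector `φ`, multiplication by `φ ⊗ φ`, its commutator with `c`, and
the double interior product by `φ♯` behave like the three weight vectors of the adjoint
representation. Hence `W = e^g e^{-c}` turns multiplication by `φ ⊗ φ` into minus the double
interior product, which is minus the adjoint of that multiplication (`weyl_mul`, `weylOp_mulSq`).

If `ω` is a combination of products of `p` squares, moving the factors across one at a time gives
`⟨α, W(ωη)⟩ = (-1)^p ⟨ωα, Wη⟩` (`dfInner_weylOp_mul`). Symmetry and the Bianchi identity are what
make `R` such a combination with `p = 2` (`mem_symm11_pow_two`). Taking `α = 1` and `ω = η = R^q`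
yields `⟨1, W R^{2q}⟩ = ⟨R^q, W R^q⟩`.

Both sides are then read off from `⟨α, Wη⟩ = ⟨e^c α, e^{-c} η⟩`, since distinct eigenspaces of the
self-adjoint `H` are orthogonal. On the left only the full contraction `c^{4q} R^{2q} / (4q)!`
survives, and it is `h_{4q}(R)` (`gaussBonnet_eq`). On the right the diagonal terms survive and give
the alternating sum (`dfInner_weylOp_self`). -/

set_option linter.unusedSectionVars false

noncomputable section

namespace DoubleForms

/-! ### Exponentials of nilpotent elements and `sl₂` relations in an associative algebra -/

section TruncatedExponential

variable {A : Type*} [Ring A] [Algebra ℝ A]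

/-- The exponential series truncated after `N` terms. -/
def truncExp (N : ℕ) (a : A) : A := ∑ r ∈ Finset.range N, (r.factorial : ℝ)⁻¹ • a ^ r

theorem truncExp_succ (N : ℕ) (a : A) :
    truncExp (N + 1) a = truncExp N a + (N.factorial : ℝ)⁻¹ • a ^ N :=
  Finset.sum_range_succ _ _

theorem truncExp_succ_of_pow_eq_zero {N : ℕ} {a : A} (h : a ^ N = 0) :
    truncExp (N + 1) a = truncExp N a := by
  simp [truncExp_succ, h]

/-- Leibniz expansion of `a^(r+2) x` through iterated commutators: `ad a` sends `x` to `z` and `z`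
to `2w`, then stops. Normalizing by `2w` absorbs the binomial denominator. -/
theorem pow_mul_of_commutators {a x z w : A} (hx : a * x = x * a + z)
    (hz : a * z = z * a + (2 : ℝ) • w) (hw : a * w = w * a) (r : ℕ) :
    a ^ (r + 2) * x = x * a ^ (r + 2) + (r + 2 : ℝ) • (z * a ^ (r + 1)) +
      ((r + 2) * (r + 1) : ℝ) • (w * a ^ r) := by
  induction r with
  | zero =>
    have e : a ^ 2 * x = a * (a * x) := by rw [pow_two, mul_assoc]
    rw [e, hx, mul_add, ← mul_assoc, hx, hz, add_mul, mul_assoc, ← pow_two]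
    simp only [Nat.cast_zero, zero_add, pow_one, pow_zero, mul_one]
    module
  | succ r ih =>
    have e : a ^ (r + 1 + 2) * x = a * (a ^ (r + 2) * x) := by rw [← mul_assoc, ← pow_succ']
    have h1 : a * (x * a ^ (r + 2)) = x * a ^ (r + 1 + 2) + z * a ^ (r + 2) := by
      rw [← mul_assoc, hx, add_mul, mul_assoc, ← pow_succ']
    have h2 : a * (z * a ^ (r + 1)) = z * a ^ (r + 2) + (2 : ℝ) • (w * a ^ (r + 1)) := by
      rw [← mul_assoc, hz, add_mul, mul_assoc, ← pow_succ', smul_mul_assoc]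
    have h3 : a * (w * a ^ r) = w * a ^ (r + 1) := by
      rw [← mul_assoc, hw, mul_assoc, ← pow_succ']
    rw [e, ih, mul_add, mul_add, mul_smul_comm, mul_smul_comm, h1, h2, h3]
    push_cast
    rw [show r + 1 + 1 = r + 2 from rfl]
    module

/-- This is `e^a x e^{-a} = e^{ad a} x`, a series with only three terms here. -/
theorem truncExp_mul_of_commutators {a x z w : A} (hx : a * x = x * a + z)
    (hz : a * z = z * a + (2 : ℝ) • w) (hw : a * w = w * a) {N : ℕ} (hN : a ^ N = 0) :
    truncExp N a * x = (x + z + w) * truncExp N a := by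
  -- Each commutator lowers the power of `a` by one, so without nilpotency the three truncations
  -- differ. They coincide once `a ^ N = 0`.
  have key : ∀ M : ℕ, truncExp (M + 2) a * x =
      x * truncExp (M + 2) a + z * truncExp (M + 1) a + w * truncExp M a := by
    intro M
    induction M with
    | zero =>
      simp [truncExp, Finset.sum_range_succ, add_mul, mul_add, hx]
      abel
    | succ M ih =>
      have e1 := truncExp_succ (M + 2) a
      have e2 := truncExp_succ (M + 1) a
      have e3 := truncExp_succ M a
      rw [show M + 1 + 2 = M + 2 + 1 from rfl, e1, add_mul, ih, e2, e3, smul_mul_assoc,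
        pow_mul_of_commutators hx hz hw]
      simp only [Nat.factorial_succ, mul_add x, mul_add z, mul_add w, mul_smul_comm, smul_add,
        smul_smul]
      push_cast
      have hM : (M.factorial : ℝ) ≠ 0 := by positivity
      have h1 : (((M : ℝ) + 1 + 1) * (((M : ℝ) + 1) * M.factorial))⁻¹ * (M + 2) =
          (((M : ℝ) + 1) * M.factorial)⁻¹ := by
        have : (M : ℝ) + 1 ≠ 0 := by positivity
        have : (M : ℝ) + 1 + 1 ≠ 0 := by positivity
        field_simp; ring
      have h2 : (((M : ℝ) + 1 + 1) * (((M : ℝ) + 1) * M.factorial))⁻¹ * ((M + 2) * (M + 1)) =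
          ((M.factorial : ℝ))⁻¹ := by
        have : (M : ℝ) + 1 ≠ 0 := by positivity
        have : (M : ℝ) + 1 + 1 ≠ 0 := by positivity
        field_simp; ring
      rw [h1, h2]
      abel
  have h1 : truncExp (N + 1) a = truncExp N a := truncExp_succ_of_pow_eq_zero hN
  have h2 : truncExp (N + 2) a = truncExp N a := by
    rw [truncExp_succ_of_pow_eq_zero (by rw [pow_succ, hN, zero_mul]), h1]
  have := key N
  rw [h1, h2] at this
  rw [this, add_mul, add_mul]

/-- Jacobi identity: `[[c, g], x] = [c, [g, x]] - [g, [c, x]] = -[g, z]`. -/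
theorem commutator_mul_raising {c g x z : A} (hcx : c * x = x * c + z) (hgx : g * x = x * g)
    (hgz : g * z = z * g + (2 : ℝ) • x) :
    (c * g - g * c) * x = x * (c * g - g * c) - (2 : ℝ) • x := by
  have h1 : c * g * x = x * (c * g) + z * g := by
    rw [mul_assoc, hgx, ← mul_assoc, hcx, add_mul, mul_assoc]
  have h2 : g * c * x = x * (g * c) + z * g + (2 : ℝ) • x := by
    rw [mul_assoc, hcx, mul_add, hgz, ← mul_assoc, hgx, mul_assoc]
    abel
  rw [sub_mul, h1, h2, mul_sub]
  abel

theorem commutator_mul_lowering {c g y z : A} (hyg : y * g = g * y + z) (hcy : c * y = y * c)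
    (hcz : c * z = z * c - (2 : ℝ) • y) :
    (c * g - g * c) * y = y * (c * g - g * c) + (2 : ℝ) • y := by
  have hgy : g * y = y * g - z := by rw [hyg]; abel
  have h1 : c * g * y = y * (c * g) - z * c + (2 : ℝ) • y := by
    rw [mul_assoc, hgy, mul_sub, hcz, ← mul_assoc, hcy, mul_assoc]
    abel
  have h2 : g * c * y = y * (g * c) - z * c := by
    rw [mul_assoc, hcy, ← mul_assoc, hgy, sub_mul, mul_assoc]
  rw [sub_mul, h1, h2, mul_sub]
  abel

/-- The operator `e^g e^{-c}`. -/
def weyl (N : ℕ) (g c : A) : A := truncExp N g * truncExp N (-c)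

/-- If `x, z, y` span a copy of the adjoint representation of the `sl₂` generated by `g` and `c`,
then `e^g e^{-c}` carries the highest vector to the opposite of the lowest one. -/
theorem weyl_mul {c g x y z : A} {N : ℕ} (hcx : c * x = x * c + z)
    (hcz : c * z = z * c - (2 : ℝ) • y) (hcy : c * y = y * c) (hgx : g * x = x * g)
    (hgz : g * z = z * g + (2 : ℝ) • x) (hyg : y * g = g * y + z) (hg : g ^ N = 0)
    (hc : c ^ N = 0) :
    weyl N g c * x = -(y * weyl N g c) := by
  have hc' : (-c) ^ N = 0 := by rw [neg_pow, hc, mul_zero]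
  have h1 : truncExp N (-c) * x = (x + -z + -y) * truncExp N (-c) := by
    refine truncExp_mul_of_commutators ?_ ?_ ?_ hc'
    · rw [neg_mul, hcx, mul_neg]; abel
    · rw [neg_mul_neg, neg_mul_neg, hcz, smul_neg]; abel
    · rw [neg_mul_neg, neg_mul_neg, hcy]
  have h2 : truncExp N g * x = x * truncExp N g := by
    have := truncExp_mul_of_commutators (a := g) (x := x) (z := 0) (w := 0)
      (by rw [hgx, add_zero]) (by simp) (by simp) hg
    simpa using this
  have h3 : truncExp N g * z = (z + (2 : ℝ) • x) * truncExp N g := by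
    have := truncExp_mul_of_commutators (a := g) (w := 0) hgz
      (by rw [mul_smul_comm, smul_mul_assoc, hgx, smul_zero, add_zero]) (by simp) hg
    simpa using this
  have h4 : truncExp N g * y = (y + -z + -x) * truncExp N g := by
    refine truncExp_mul_of_commutators ?_ ?_ ?_ hg
    · rw [hyg]; abel
    · rw [mul_neg, hgz, smul_neg, neg_mul]; abel
    · rw [mul_neg, neg_mul, hgx]
  -- Conjugation by `e^g` turns `x - z - y` into `x - (z + 2x) - (y - z - x) = -y`.
  have h5 : truncExp N g * (x + -z + -y) = -(y * truncExp N g) := by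
    rw [mul_add, mul_add, mul_neg, mul_neg, h2, h3, h4]
    simp only [add_mul, neg_mul, smul_mul_assoc]
    module
  rw [weyl, mul_assoc, h1, ← mul_assoc, h5, neg_mul, mul_assoc]

theorem add_pow_succ_of_sq_eq_zero {a s : A} (h : Commute a s) (ha : a * a = 0) (k : ℕ) :
    (a + s) ^ (k + 1) = s ^ (k + 1) + (k + 1 : ℝ) • (a * s ^ k) := by
  induction k with
  | zero => simp [add_comm]
  | succ k ih =>
    have e1 : s * (a * s ^ k) = a * s ^ (k + 1) := by
      rw [← mul_assoc, ← h.eq, mul_assoc, ← pow_succ']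
    have e2 : a * (a * s ^ k) = 0 := by rw [← mul_assoc, ha, zero_mul]
    rw [pow_succ', ih, add_mul, mul_add, mul_add, mul_smul_comm, mul_smul_comm, e1, e2,
      ← pow_succ']
    push_cast
    module

/-- A sum of commuting elements of square zero has a power given by their product. -/
theorem list_sum_pow_of_sq_eq_zero (l : List A) (hc : ∀ a ∈ l, ∀ b ∈ l, Commute a b)
    (hs : ∀ a ∈ l, a * a = 0) :
    l.sum ^ l.length = (l.length.factorial : ℝ) • l.prod ∧ l.sum ^ (l.length + 1) = 0 := by
  induction l with
  | nil => simp
  | cons a l ih =>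
    obtain ⟨h1, h2⟩ := ih (fun x hx y hy => hc x (by simp [hx]) y (by simp [hy]))
      (fun x hx => hs x (by simp [hx]))
    have hcom : Commute a l.sum :=
      Commute.list_sum_right a l fun b hb => hc a (by simp) b (by simp [hb])
    have ha : a * a = 0 := hs a (by simp)
    simp only [List.sum_cons, List.length_cons, List.prod_cons]
    constructor
    · rw [add_pow_succ_of_sq_eq_zero hcom ha, h2, h1, zero_add, mul_smul_comm, smul_smul,
        Nat.factorial_succ]
      push_cast; rfl
    · rw [add_pow_succ_of_sq_eq_zero hcom ha, h2, pow_succ, h2]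
      simp

end TruncatedExponential

/-! ### Exterior and interior multiplication on double forms -/

section Operators

variable {V : Type*} [AddCommGroup V] [Module ℝ V]

/-- Left exterior multiplication by a covector. -/
def wedge (φ : Module.Dual ℝ V) : Forms V →ₗ[ℝ] Forms V :=
  LinearMap.mulLeft ℝ (ExteriorAlgebra.ι ℝ φ)

theorem wedge_apply (φ : Module.Dual ℝ V) (θ : Forms V) :
    wedge φ θ = ExteriorAlgebra.ι ℝ φ * θ := rfl

theorem wedge_wedge (φ ψ : Module.Dual ℝ V) (θ : Forms V) :
    wedge φ (wedge ψ θ) = -wedge ψ (wedge φ θ) := by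
  rw [wedge_apply, wedge_apply, wedge_apply, wedge_apply, ← mul_assoc, ← mul_assoc,
    eq_neg_iff_add_eq_zero, ← add_mul, ExteriorAlgebra.ι_add_mul_swap, zero_mul]

theorem interior_interior (v w : V) (θ : Forms V) :
    interior v (interior w θ) = -interior w (interior v θ) :=
  by
  rw [interior, interior, CliffordAlgebra.contractLeft_comm]

theorem interior_self (v : V) (θ : Forms V) : interior v (interior v θ) = 0 :=
  CliffordAlgebra.contractLeft_contractLeft _ _

theorem interior_wedge (v : V) (φ : Module.Dual ℝ V) (θ : Forms V) :
    interior v (wedge φ θ) = φ v • θ - wedge φ (interior v θ) :=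
  CliffordAlgebra.contractLeft_ι_mul (d := Module.Dual.eval ℝ V v) φ θ

theorem interior_one (v : V) : interior v (1 : Forms V) = 0 :=
  CliffordAlgebra.contractLeft_one _ (Module.Dual.eval ℝ V v)

theorem interior_smul (c : ℝ) (v : V) (θ : Forms V) :
    interior (c • v) θ = c • interior v θ := by
  simp [interior]

theorem interior_sum {ι : Type*} (s : Finset ι) (v : ι → V) (θ : Forms V) :
    interior (∑ i ∈ s, v i) θ = ∑ i ∈ s, interior (v i) θ := by
  simp [interior]

theorem wedge_sum {ι : Type*} (s : Finset ι) (φ : ι → Module.Dual ℝ V) (θ : Forms V) :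
    wedge (∑ i ∈ s, φ i) θ = ∑ i ∈ s, wedge (φ i) θ := by
  simp [wedge_apply, Finset.sum_mul]

theorem wedge_smul (c : ℝ) (φ : Module.Dual ℝ V) (θ : Forms V) :
    wedge (c • φ) θ = c • wedge φ θ := by
  simp [wedge_apply]

/-- The square `φ ⊗ φ` of a covector, a symmetric `(1,1)` double form. -/
def sq (φ : Module.Dual ℝ V) : DoubleForm V :=
  ExteriorAlgebra.ι ℝ φ ⊗ₜ[ℝ] ExteriorAlgebra.ι ℝ φ

/-- Multiplication by `φ ⊗ φ`. -/
def mulSq (φ : Module.Dual ℝ V) : Module.End ℝ (DoubleForm V) :=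
  TensorProduct.map (wedge φ) (wedge φ)

/-- Double interior product by `v ⊗ v`. -/
def intSq (v : V) : Module.End ℝ (DoubleForm V) :=
  TensorProduct.map (interior v) (interior v)

theorem mulSq_apply (φ : Module.Dual ℝ V) (ω : DoubleForm V) : mulSq φ ω = sq φ * ω := by
  induction ω using TensorProduct.induction_on with
  | zero => simp
  | tmul a b => simp [mulSq, sq, wedge_apply]
  | add a b ha hb => rw [map_add, ha, hb, mul_add]

@[simp] theorem mulSq_tmul (φ : Module.Dual ℝ V) (a b : Forms V) :
    mulSq φ (a ⊗ₜ[ℝ] b) = wedge φ a ⊗ₜ[ℝ] wedge φ b := rfl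

@[simp] theorem intSq_tmul (v : V) (a b : Forms V) :
    intSq v (a ⊗ₜ[ℝ] b) = interior v a ⊗ₜ[ℝ] interior v b := rfl

theorem sq_mul_self (φ : Module.Dual ℝ V) : sq φ * sq φ = 0 := by
  simp [sq]

theorem sq_commute (φ ψ : Module.Dual ℝ V) : Commute (sq φ) (sq ψ) := by
  have h := eq_neg_of_add_eq_zero_left (ExteriorAlgebra.ι_add_mul_swap (R := ℝ) φ ψ)
  simp only [Commute, SemiconjBy, sq, Algebra.TensorProduct.tmul_mul_tmul]
  rw [h, TensorProduct.neg_tmul, TensorProduct.tmul_neg, neg_neg]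

theorem intSq_mul_self (v : V) : intSq v * intSq v = 0 := by
  refine TensorProduct.ext' fun a b => ?_
  simp [interior_self]

theorem intSq_commute (v w : V) : Commute (intSq v) (intSq w) := by
  refine TensorProduct.ext' fun a b => ?_
  simp only [Module.End.mul_apply, intSq_tmul]
  rw [interior_interior v w a, interior_interior v w b, TensorProduct.neg_tmul,
    TensorProduct.tmul_neg, neg_neg]

theorem intSq_one (v : V) : intSq v (1 : DoubleForm V) = 0 := by
  rw [Algebra.TensorProduct.one_def, intSq_tmul, interior_one, TensorProduct.zero_tmul]

end Operators

/-! ### Commutation relations of the metric, the contraction and squares of covectors -/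

section Euclidean

variable {V : Type*} [NormedAddCommGroup V] [InnerProductSpace ℝ V] [FiniteDimensional ℝ V]
variable {n : ℕ} (e : OrthonormalBasis (Fin n) ℝ V)

theorem inner_sharp (φ : Module.Dual ℝ V) (v : V) : inner ℝ (sharp φ) v = φ v := by
  simp [sharp]

theorem sum_apply_smul_basis (φ : Module.Dual ℝ V) : ∑ i, φ (e i) • e i = sharp φ := by
  rw [← e.sum_repr' (sharp φ)]
  simp [real_inner_comm, ← inner_sharp φ]

theorem sum_apply_smul_coframe (φ : Module.Dual ℝ V) : ∑ i, φ (e i) • coframe e i = φ := by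
  ext v
  simp only [LinearMap.sum_apply, LinearMap.smul_apply, coframe, innerₗ_apply_apply, smul_eq_mul]
  conv_rhs => rw [← e.sum_repr' v]
  simp [mul_comm]

theorem sharp_coframe (i : Fin n) : sharp (coframe e i) = e i := by
  refine ext_inner_right ℝ fun v => ?_
  rw [inner_sharp]; rfl

theorem apply_sharp_comm (φ ψ : Module.Dual ℝ V) : φ (sharp ψ) = ψ (sharp φ) := by
  rw [← inner_sharp, ← inner_sharp, real_inner_comm]

theorem apply_sharp_eq_sum (φ ψ : Module.Dual ℝ V) :
    φ (sharp ψ) = ∑ i, φ (e i) * ψ (e i) := by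
  rw [← sum_apply_smul_basis e ψ, map_sum]
  simp [mul_comm]

/-- Multiplication by the metric. -/
def mulMetric : Module.End ℝ (DoubleForm V) := ∑ i, mulSq (coframe e i)

theorem contraction_eq : contraction e = ∑ i, intSq (e i) := rfl

theorem contraction_tmul (a b : Forms V) :
    contraction e (a ⊗ₜ[ℝ] b) = ∑ i, interior (e i) a ⊗ₜ[ℝ] interior (e i) b := by
  simp [contraction]

/-- The commutator of the contraction with the multiplication by `φ ⊗ φ`. -/
def weight (φ : Module.Dual ℝ V) : Module.End ℝ (DoubleForm V) :=
  φ (sharp φ) • LinearMap.id -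
    TensorProduct.map (wedge φ ∘ₗ interior (sharp φ)) LinearMap.id -
    TensorProduct.map LinearMap.id (wedge φ ∘ₗ interior (sharp φ))

@[simp] theorem weight_tmul (φ : Module.Dual ℝ V) (a b : Forms V) :
    weight φ (a ⊗ₜ[ℝ] b) = φ (sharp φ) • (a ⊗ₜ[ℝ] b) -
      wedge φ (interior (sharp φ) a) ⊗ₜ[ℝ] b - a ⊗ₜ[ℝ] wedge φ (interior (sharp φ) b) := rfl

theorem sum_tmul_interior (φ : Module.Dual ℝ V) (a b : Forms V) :
    ∑ i, φ (e i) • (a ⊗ₜ[ℝ] interior (e i) b) = a ⊗ₜ[ℝ] interior (sharp φ) b := by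
  rw [← sum_apply_smul_basis e φ, interior_sum, TensorProduct.tmul_sum]
  simp [interior_smul]

theorem sum_interior_tmul (φ : Module.Dual ℝ V) (a b : Forms V) :
    ∑ i, φ (e i) • (interior (e i) a ⊗ₜ[ℝ] b) = interior (sharp φ) a ⊗ₜ[ℝ] b := by
  rw [← sum_apply_smul_basis e φ, interior_sum, TensorProduct.sum_tmul]
  simp [interior_smul, TensorProduct.smul_tmul']

theorem sum_tmul_wedge (φ : Module.Dual ℝ V) (a b : Forms V) :
    ∑ i, φ (e i) • (a ⊗ₜ[ℝ] wedge (coframe e i) b) = a ⊗ₜ[ℝ] wedge φ b := by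
  conv_rhs => rw [← sum_apply_smul_coframe e φ, wedge_sum, TensorProduct.tmul_sum]
  simp [wedge_smul]

theorem sum_wedge_tmul (φ : Module.Dual ℝ V) (a b : Forms V) :
    ∑ i, φ (e i) • (wedge (coframe e i) a ⊗ₜ[ℝ] b) = wedge φ a ⊗ₜ[ℝ] b := by
  conv_rhs => rw [← sum_apply_smul_coframe e φ, wedge_sum, TensorProduct.sum_tmul]
  simp [wedge_smul, TensorProduct.smul_tmul']

theorem contraction_mulSq (φ : Module.Dual ℝ V) :
    contraction e * mulSq φ = mulSq φ * contraction e + weight φ := by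
  refine TensorProduct.ext' fun a b => ?_
  simp only [Module.End.mul_apply, LinearMap.add_apply, mulSq_tmul, contraction_tmul, map_sum,
    interior_wedge, TensorProduct.sub_tmul, TensorProduct.tmul_sub, TensorProduct.tmul_smul,
    ← TensorProduct.smul_tmul', Finset.sum_sub_distrib, smul_sub, smul_smul, weight_tmul]
  rw [← Finset.sum_smul, ← apply_sharp_eq_sum]
  have h1 := congrArg (TensorProduct.map (wedge φ) LinearMap.id) (sum_interior_tmul e φ a b)
  have h2 := congrArg (TensorProduct.map LinearMap.id (wedge φ)) (sum_tmul_interior e φ a b)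
  simp only [map_sum, map_smul, TensorProduct.map_tmul, LinearMap.id_apply] at h1 h2
  rw [h1, h2]
  abel

/-- The commutator is the same operator `weight φ` as in `contraction_mulSq`. This coincidence links
the raising and lowering operators into one adjoint triple. -/
theorem intSq_mulMetric (φ : Module.Dual ℝ V) :
    intSq (sharp φ) * mulMetric e = mulMetric e * intSq (sharp φ) + weight φ := by
  refine TensorProduct.ext' fun a b => ?_
  simp only [mulMetric, Module.End.mul_apply, LinearMap.add_apply, LinearMap.sum_apply, mulSq_tmul,
    intSq_tmul, map_sum, weight_tmul,
    interior_wedge, TensorProduct.sub_tmul, TensorProduct.tmul_sub, TensorProduct.tmul_smul,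
    ← TensorProduct.smul_tmul', Finset.sum_sub_distrib, smul_sub, smul_smul]
  have hc : ∀ i, coframe e i (sharp φ) = φ (e i) := fun i => by
    rw [apply_sharp_comm, sharp_coframe]
  simp only [hc]
  rw [← Finset.sum_smul, ← apply_sharp_eq_sum, sum_tmul_wedge, sum_wedge_tmul]
  abel

theorem contraction_weight (φ : Module.Dual ℝ V) :
    contraction e * weight φ = weight φ * contraction e - (2 : ℝ) • intSq (sharp φ) := by
  refine TensorProduct.ext' fun a b => ?_
  simp only [Module.End.mul_apply, LinearMap.sub_apply, LinearMap.smul_apply, weight_tmul,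
    intSq_tmul, map_sub, map_smul, contraction_tmul, map_sum, Finset.sum_sub_distrib,
    interior_wedge, interior_interior (e _) (sharp φ), map_neg,
    TensorProduct.sub_tmul, TensorProduct.tmul_sub, TensorProduct.tmul_smul,
    ← TensorProduct.smul_tmul', TensorProduct.neg_tmul, TensorProduct.tmul_neg,
    Finset.sum_neg_distrib, ← Finset.smul_sum]
  have h1 := sum_tmul_interior e φ (interior (sharp φ) a) b
  have h2 := sum_interior_tmul e φ a (interior (sharp φ) b)
  rw [h1, h2]
  module

theorem mulMetric_weight (φ : Module.Dual ℝ V) :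
    mulMetric e * weight φ = weight φ * mulMetric e + (2 : ℝ) • mulSq φ := by
  refine TensorProduct.ext' fun a b => ?_
  have hc : ∀ i, coframe e i (sharp φ) = φ (e i) := fun i => by
    rw [apply_sharp_comm, sharp_coframe]
  simp only [mulMetric, Module.End.mul_apply, LinearMap.add_apply, LinearMap.sum_apply, mulSq_tmul,
    LinearMap.smul_apply, map_sub, map_smul, map_sum, Finset.sum_sub_distrib,
    interior_wedge, weight_tmul, hc,
    TensorProduct.sub_tmul, TensorProduct.tmul_sub, TensorProduct.tmul_smul,
    ← TensorProduct.smul_tmul', wedge_wedge φ (coframe e _), TensorProduct.neg_tmul,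
    TensorProduct.tmul_neg, Finset.sum_neg_distrib, ← Finset.smul_sum]
  have h1 := sum_tmul_wedge e φ (wedge φ a) b
  have h2 := sum_wedge_tmul e φ a (wedge φ b)
  rw [h1, h2]
  module

theorem contraction_intSq (v : V) : contraction e * intSq v = intSq v * contraction e := by
  rw [contraction_eq, Finset.sum_mul, Finset.mul_sum]
  exact Finset.sum_congr rfl fun i _ => intSq_commute _ _

theorem mulSq_commute (φ ψ : Module.Dual ℝ V) : Commute (mulSq φ) (mulSq ψ) := by
  refine LinearMap.ext fun ω => ?_
  simp only [Module.End.mul_apply, mulSq_apply, ← mul_assoc, (sq_commute φ ψ).eq]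

theorem mulMetric_mulSq (φ : Module.Dual ℝ V) :
    mulMetric e * mulSq φ = mulSq φ * mulMetric e := by
  rw [mulMetric, Finset.sum_mul, Finset.mul_sum]
  exact Finset.sum_congr rfl fun i _ => mulSq_commute _ _

/-- The cross term `φ ⊗ ψ + ψ ⊗ φ` is written by polarization as a combination of squares, so that
`weight φ` visibly preserves `symm11 V ^ p`. -/
theorem weight_mulSq (φ ψ : Module.Dual ℝ V) :
    weight φ * mulSq ψ = mulSq ψ * weight φ -
      ψ (sharp φ) • (mulSq (φ + ψ) - mulSq φ - mulSq ψ) := by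
  refine TensorProduct.ext' fun a b => ?_
  have hw : ∀ c : Forms V, wedge (φ + ψ) c = wedge φ c + wedge ψ c := fun c => by
    simp [wedge_apply, add_mul]
  simp only [Module.End.mul_apply, LinearMap.sub_apply, LinearMap.smul_apply, mulSq_tmul, map_sub,
    map_smul, interior_wedge, weight_tmul, hw, TensorProduct.sub_tmul, TensorProduct.tmul_sub,
    TensorProduct.tmul_smul, TensorProduct.add_tmul, TensorProduct.tmul_add,
    ← TensorProduct.smul_tmul', wedge_wedge φ ψ, TensorProduct.neg_tmul, TensorProduct.tmul_neg]
  module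

theorem weight_one (φ : Module.Dual ℝ V) :
    weight φ (1 : DoubleForm V) = φ (sharp φ) • 1 := by
  rw [Algebra.TensorProduct.one_def, weight_tmul, interior_one, map_zero,
    TensorProduct.zero_tmul, TensorProduct.tmul_zero, sub_zero, sub_zero]

theorem contraction_one : contraction e (1 : DoubleForm V) = 0 := by
  rw [contraction_eq, LinearMap.sum_apply]
  exact Finset.sum_eq_zero fun i _ => intSq_one _

theorem isNilpotent_contraction : IsNilpotent (contraction e) := by
  rw [contraction_eq]
  exact Commute.isNilpotent_sum (fun i _ => ⟨2, by rw [pow_two, intSq_mul_self]⟩)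
    fun _ _ _ _ => intSq_commute _ _

theorem isNilpotent_mulMetric : IsNilpotent (mulMetric e) := by
  refine Commute.isNilpotent_sum (fun i _ => ⟨2, ?_⟩) fun _ _ _ _ => mulSq_commute _ _
  refine LinearMap.ext fun ω => ?_
  simp [pow_two, mulSq_apply, ← mul_assoc, sq_mul_self]

end Euclidean

/-! ### Evaluation of forms and interior products -/

section Evaluation

variable {V : Type*} [AddCommGroup V] [Module ℝ V]

theorem interior_ιMulti (v : V) {k : ℕ} (ψ : Fin (k + 1) → Module.Dual ℝ V) :
    interior v (ExteriorAlgebra.ιMulti ℝ (k + 1) ψ) =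
      ∑ j : Fin (k + 1), ((-1 : ℝ) ^ (j : ℕ) * ψ j v) •
        ExteriorAlgebra.ιMulti ℝ k fun i => ψ (j.succAbove i) := by
  induction k with
  | zero =>
    rw [ExteriorAlgebra.ιMulti_succ_apply, ← wedge_apply, interior_wedge]
    simp [interior_one]
  | succ k ih =>
    rw [ExteriorAlgebra.ιMulti_succ_apply, ← wedge_apply, interior_wedge, ih,
      Fin.sum_univ_succ (n := k + 1), map_sum, sub_eq_add_neg, ← Finset.sum_neg_distrib]
    congr 1
    · simp [Matrix.vecTail, Function.comp_def]
    · refine Finset.sum_congr rfl fun j _ => ?_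
      rw [map_smul, wedge_apply, ExteriorAlgebra.ιMulti_succ_apply, ← neg_smul]
      congr 1
      · simp [Matrix.vecTail, pow_succ]
      · simp [Matrix.vecTail, Function.comp_def]

/-- On decomposable forms this is the Laplace expansion of the determinant along its first column.
-/
theorem evalForm_cons (v : V) {p : ℕ} (x : Fin p → V) (θ : Forms V) :
    evalForm (Fin.cons v x : Fin (p + 1) → V) θ = evalForm x (interior v θ) := by
  suffices h : evalForm (Fin.cons v x : Fin (p + 1) → V) = evalForm x ∘ₗ interior v from
    LinearMap.congr_fun h θ
  ext k φ
  simp only [LinearMap.compAlternatingMap_apply, LinearMap.comp_apply]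
  cases k with
  | zero =>
    rw [evalForm_ιMulti_of_ne (by omega), ExteriorAlgebra.ιMulti_zero_apply, interior_one, map_zero]
  | succ k =>
    rw [interior_ιMulti, map_sum]
    simp only [map_smul, smul_eq_mul]
    by_cases h : k = p
    · subst h
      simp only [evalForm_ιMulti]
      rw [Matrix.det_succ_column_zero]
      rfl
    · rw [evalForm_ιMulti_of_ne (by omega)]
      simp [evalForm_ιMulti_of_ne h]

theorem evalForm_elim0_one : evalForm (Fin.elim0 : Fin 0 → V) (1 : Forms V) = 1 := by
  rw [← ExteriorAlgebra.ιMulti_zero_apply (R := ℝ) (Fin.elim0 : Fin 0 → Module.Dual ℝ V),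
    evalForm_ιMulti]
  simp

end Evaluation

/-! ### Adjointness, the Hodge star and the volume form -/

section Euclidean

variable {V : Type*} [NormedAddCommGroup V] [InnerProductSpace ℝ V] [FiniteDimensional ℝ V]

theorem formInner_ιMulti {p : ℕ} (φ : Fin p → Module.Dual ℝ V) (b : Forms V) :
    formInner (ExteriorAlgebra.ιMulti ℝ p φ) b = evalForm (fun i => sharp (φ i)) b := by
  rw [formInner, ExteriorAlgebra.liftAlternating_apply_ιMulti]
  rfl

theorem formInner_wedge (φ : Module.Dual ℝ V) (a b : Forms V) :
    formInner (wedge φ a) b = formInner a (interior (sharp φ) b) := by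
  suffices h : formInner ∘ₗ wedge φ =
      LinearMap.lcomp ℝ ℝ (interior (sharp φ)) ∘ₗ (formInner (V := V)) from
    LinearMap.congr_fun₂ h a b
  ext k ψ b
  simp only [LinearMap.compAlternatingMap_apply, LinearMap.comp_apply, LinearMap.lcomp_apply,
    formInner_ιMulti]
  rw [← evalForm_cons, wedge_apply, show ExteriorAlgebra.ι ℝ φ * ExteriorAlgebra.ιMulti ℝ k ψ =
    ExteriorAlgebra.ιMulti ℝ (k + 1) (Fin.cons φ ψ) by
      rw [ExteriorAlgebra.ιMulti_succ_apply]; simp [Matrix.vecTail, Function.comp_def],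
    formInner_ιMulti]
  congr 2
  funext i
  refine Fin.cases ?_ (fun j => ?_) i <;> simp

theorem formInner_comm (a b : Forms V) : formInner a b = formInner b a := by
  suffices h : formInner (V := V) = LinearMap.flip formInner from LinearMap.congr_fun₂ h a b
  ext k φ l ψ
  simp only [LinearMap.compAlternatingMap_apply, LinearMap.flip_apply, formInner_ιMulti]
  by_cases h : k = l
  · subst h
    rw [evalForm_ιMulti, evalForm_ιMulti, ← Matrix.det_transpose]
    congr 1
    ext i j
    simp [apply_sharp_comm (ψ j)]
  · rw [evalForm_ιMulti_of_ne h, evalForm_ιMulti_of_ne (Ne.symm h)]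

@[simp] theorem dfInner_tmul (a b c d : Forms V) :
    dfInner (a ⊗ₜ[ℝ] b) (c ⊗ₜ[ℝ] d) = formInner a c * formInner b d := by
  simp [dfInner, LinearMap.BilinForm.tensorDistrib_tmul, mul_comm]

theorem dfInner_comm (ω η : DoubleForm V) : dfInner ω η = dfInner η ω := by
  induction ω using TensorProduct.induction_on with
  | zero => simp
  | add x y hx hy => simp only [map_add, LinearMap.add_apply, hx, hy]
  | tmul a b =>
    induction η using TensorProduct.induction_on with
    | zero => simp
    | add x y hx hy => simp only [map_add, LinearMap.add_apply, hx, hy]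
    | tmul c d => rw [dfInner_tmul, dfInner_tmul, formInner_comm a, formInner_comm b]

theorem dfInner_mulSq (φ : Module.Dual ℝ V) (ω η : DoubleForm V) :
    dfInner (mulSq φ ω) η = dfInner ω (intSq (sharp φ) η) := by
  induction ω using TensorProduct.induction_on with
  | zero => simp
  | add x y hx hy => simp only [map_add, LinearMap.add_apply, hx, hy]
  | tmul a b =>
    induction η using TensorProduct.induction_on with
    | zero => simp
    | add x y hx hy => simp only [map_add, hx, hy]
    | tmul c d => simp [formInner_wedge]

variable {n : ℕ} (e : OrthonormalBasis (Fin n) ℝ V)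

theorem dfInner_mulMetric (ω η : DoubleForm V) :
    dfInner (mulMetric e ω) η = dfInner ω (contraction e η) := by
  simp only [mulMetric, contraction_eq, LinearMap.sum_apply, map_sum, dfInner_mulSq, sharp_coframe]

theorem dfInner_contraction (ω η : DoubleForm V) :
    dfInner (contraction e ω) η = dfInner ω (mulMetric e η) := by
  rw [dfInner_comm, ← dfInner_mulMetric, dfInner_comm]

theorem dfInner_mulMetric_pow (k : ℕ) (ω η : DoubleForm V) :
    dfInner ((mulMetric e ^ k) ω) η = dfInner ω ((contraction e ^ k) η) := by
  induction k generalizing ω with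
  | zero => simp
  | succ k ih =>
    rw [pow_succ, pow_succ', Module.End.mul_apply, Module.End.mul_apply, ih, dfInner_mulMetric]

theorem mulMetric_apply (ω : DoubleForm V) : mulMetric e ω = metric e * ω := by
  rw [mulMetric, metric, LinearMap.sum_apply, Finset.sum_mul]
  exact Finset.sum_congr rfl fun i _ => mulSq_apply _ _

theorem mulMetric_pow_apply (k : ℕ) (ω : DoubleForm V) :
    (mulMetric e ^ k) ω = metric e ^ k * ω := by
  induction k with
  | zero => simp
  | succ k ih => rw [pow_succ', Module.End.mul_apply, ih, mulMetric_apply, pow_succ', mul_assoc]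

/-- The double form `vol ⊗ vol`. -/
def volSq : DoubleForm V := basisForm e Finset.univ ⊗ₜ[ℝ] basisForm e Finset.univ

theorem evalForm_elim0_hodge (β : Forms V) :
    evalForm (Fin.elim0 : Fin 0 → V) (hodge e β) = formInner (basisForm e Finset.univ) β := by
  simp only [hodge, LinearMap.sum_apply, map_sum, LinearMap.smulRight_apply, LinearMap.comp_apply,
    LinearMap.mulRight_apply, map_smul, smul_eq_mul]
  -- Evaluation on no vectors sees only the degree zero part of `*β`, which comes from `I = ∅`.
  rw [Finset.sum_eq_single ∅]
  · have h : basisForm e ∅ = 1 := ExteriorAlgebra.ιMulti_zero_apply _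
    rw [h, evalForm_elim0_one, mul_one, mul_one]
  · intro I _ hI
    have h : evalForm (Fin.elim0 : Fin 0 → V) (basisForm e I) = 0 :=
      evalForm_ιMulti_of_ne (by simpa using hI) _ _
    rw [h, mul_zero]
  · simp

theorem eval_elim0_doubleHodge (ζ : DoubleForm V) :
    eval (Fin.elim0 : Fin 0 → V) (Fin.elim0 : Fin 0 → V) (doubleHodge e ζ) =
      dfInner (volSq e) ζ := by
  induction ζ using TensorProduct.induction_on with
  | zero => simp
  | add x y hx hy => simp only [map_add, hx, hy]
  | tmul c d => simp [doubleHodge, eval, volSq, evalForm_elim0_hodge]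

theorem list_prod_tmul_self (l : List (Module.Dual ℝ V)) :
    (l.map (ExteriorAlgebra.ι ℝ)).prod ⊗ₜ[ℝ] (l.map (ExteriorAlgebra.ι ℝ)).prod =
      (l.map sq).prod := by
  induction l with
  | nil => rfl
  | cons φ l ih =>
    rw [List.map_cons, List.map_cons, List.prod_cons, List.prod_cons, ← ih, sq,
      Algebra.TensorProduct.tmul_mul_tmul]

/-- The metric is a sum of `n` commuting elements of square zero, so only the `n!` orderings of
their full product survive in the power. -/
theorem metric_pow_finrank : metric e ^ n = (n.factorial : ℝ) • volSq e := by
  set f : Fin (Finset.univ : Finset (Fin n)).card → Module.Dual ℝ V :=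
    fun i => coframe e (Finset.univ.orderEmbOfFin rfl i)
  have h := (list_sum_pow_of_sq_eq_zero ((List.ofFn f).map sq)
    (by simp only [List.mem_map]; rintro _ ⟨φ, -, rfl⟩ _ ⟨ψ, -, rfl⟩; exact sq_commute φ ψ)
    (by simp only [List.mem_map]; rintro _ ⟨φ, -, rfl⟩; exact sq_mul_self φ)).1
  have hsum : ((List.ofFn f).map sq).sum = metric e := by
    rw [List.map_ofFn, List.sum_ofFn, metric]
    have := Finset.sum_map Finset.univ
      ((Finset.univ : Finset (Fin n)).orderEmbOfFin rfl).toEmbedding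
      (fun i => sq (coframe e i))
    rw [Finset.map_orderEmbOfFin_univ] at this
    exact this.symm
  have hprod : ((List.ofFn f).map sq).prod = volSq e := by
    rw [← list_prod_tmul_self, volSq, basisForm, ExteriorAlgebra.ιMulti_apply, List.map_ofFn]
    rfl
  have hlen : ((List.ofFn f).map sq).length = n := by
    rw [List.length_map, List.length_ofFn, Finset.card_univ, Fintype.card_fin]
  rwa [hsum, hprod, hlen] at h

end Euclidean

/-! ### Curvature tensors as combinations of products of squares -/

section Span

variable {V : Type*} [AddCommGroup V] [Module ℝ V]

variable (V) in
/-- The space of symmetric `(1,1)` double forms, spanned by the squares of covectors. -/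
def symm11 : Submodule ℝ (DoubleForm V) := Submodule.span ℝ (Set.range sq)

theorem sq_mem_symm11 (φ : Module.Dual ℝ V) : sq φ ∈ symm11 V :=
  Submodule.subset_span ⟨φ, rfl⟩

/-- The symmetrized product `(a ∧ b) ⊗ (c ∧ d) + (c ∧ d) ⊗ (a ∧ b)`. -/
def symmProd (a b c d : Module.Dual ℝ V) : DoubleForm V :=
  (ExteriorAlgebra.ι ℝ a * ExteriorAlgebra.ι ℝ b) ⊗ₜ[ℝ]
      (ExteriorAlgebra.ι ℝ c * ExteriorAlgebra.ι ℝ d) +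
    (ExteriorAlgebra.ι ℝ c * ExteriorAlgebra.ι ℝ d) ⊗ₜ[ℝ]
      (ExteriorAlgebra.ι ℝ a * ExteriorAlgebra.ι ℝ b)

theorem symmProd_swap (a b c d : Module.Dual ℝ V) :
    symmProd b a c d = -symmProd a b c d := by
  have h := eq_neg_of_add_eq_zero_left (ExteriorAlgebra.ι_add_mul_swap (R := ℝ) b a)
  rw [symmProd, symmProd, h, TensorProduct.neg_tmul, TensorProduct.tmul_neg]
  abel

theorem sq_mul_sq_mem (a b : Module.Dual ℝ V) : sq a * sq b ∈ symm11 V ^ 2 := by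
  rw [pow_two]
  exact Submodule.mul_mem_mul (sq_mem_symm11 a) (sq_mem_symm11 b)

theorem symmProd_same_mem (a b d : Module.Dual ℝ V) : symmProd a b a d ∈ symm11 V ^ 2 := by
  have h : symmProd a b a d = sq a * sq (b + d) - sq a * sq b - sq a * sq d := by
    simp only [symmProd, sq, Algebra.TensorProduct.tmul_mul_tmul, map_add, mul_add,
      TensorProduct.add_tmul, TensorProduct.tmul_add]
    abel
  rw [h]
  exact sub_mem (sub_mem (sq_mul_sq_mem _ _) (sq_mul_sq_mem _ _)) (sq_mul_sq_mem _ _)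

/-- Polarizing `symmProd_same_mem` in the repeated covector shows that, modulo `symm11 V ^ 2`, the
symmetrized product is alternating in `a` and `c`. Being alternating in `a` and `b` as well, it is
cyclically invariant in `a, b, c`. -/
theorem symmProd_sub_cycle_mem (a b c d : Module.Dual ℝ V) :
    symmProd a b c d - symmProd b c a d ∈ symm11 V ^ 2 := by
  have h : symmProd a b c d - symmProd b c a d =
      symmProd (a + c) b (a + c) d - symmProd a b a d - symmProd c b c d := by
    rw [symmProd_swap c b]
    simp only [symmProd, map_add, add_mul, TensorProduct.add_tmul, TensorProduct.tmul_add]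
    abel
  rw [h]
  exact sub_mem (sub_mem (symmProd_same_mem _ _ _) (symmProd_same_mem _ _ _))
    (symmProd_same_mem _ _ _)

theorem three_symmProd_sub_mem (a b c d : Module.Dual ℝ V) :
    (3 : ℝ) • symmProd a b c d -
      (symmProd a b c d + symmProd b c a d + symmProd c a b d) ∈ symm11 V ^ 2 := by
  have h : (3 : ℝ) • symmProd a b c d -
      (symmProd a b c d + symmProd b c a d + symmProd c a b d) =
      (2 : ℝ) • (symmProd a b c d - symmProd b c a d) +
        (symmProd b c a d - symmProd c a b d) := by module
  rw [h]
  exact add_mem (Submodule.smul_mem _ _ (symmProd_sub_cycle_mem _ _ _ _))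
    (symmProd_sub_cycle_mem _ _ _ _)

theorem evalForm_pair_swap (u v : V) (θ : Forms V) :
    evalForm ![v, u] θ = -evalForm ![u, v] θ := by
  have h : ∀ a b : V, evalForm ![a, b] θ =
      evalForm (Fin.elim0 : Fin 0 → V) (interior b (interior a θ)) := fun a b => by
    rw [← evalForm_cons, ← evalForm_cons]
    congr 2
  rw [h, h, interior_interior, map_neg]

theorem eval_pair_swap (u v x y : V) (ω : DoubleForm V) :
    eval ![v, u] ![x, y] ω = -eval ![u, v] ![x, y] ω := by
  induction ω using TensorProduct.induction_on with
  | zero => simp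
  | add a b ha hb => rw [map_add, map_add, ha, hb, neg_add]
  | tmul a b => simp [eval, evalForm_pair_swap u v a]

end Span

section Euclidean

variable {V : Type*} [NormedAddCommGroup V] [InnerProductSpace ℝ V]
variable {n : ℕ} (e : OrthonormalBasis (Fin n) ℝ V)

/-- The form `eⁱ ∧ eʲ`. -/
def framePair (i j : Fin n) : Forms V :=
  ExteriorAlgebra.ι ℝ (coframe e i) * ExteriorAlgebra.ι ℝ (coframe e j)

/-- The map `θ ↦ ½ ∑ᵢⱼ θ(eᵢ, eⱼ) eⁱ ∧ eʲ`, the projection onto forms of degree two. -/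
def degreeTwoPart : Forms V →ₗ[ℝ] Forms V :=
  (2⁻¹ : ℝ) • ∑ i, ∑ j, (evalForm ![e i, e j]).smulRight (framePair e i j)

theorem ι_mul_ι_eq_sum (φ ψ : Module.Dual ℝ V) :
    ∑ i, ∑ j, (φ (e i) * ψ (e j)) • framePair e i j =
      ExteriorAlgebra.ι ℝ φ * ExteriorAlgebra.ι ℝ ψ := by
  have h : ∀ φ : Module.Dual ℝ V, ExteriorAlgebra.ι ℝ φ =
      ∑ i, φ (e i) • ExteriorAlgebra.ι ℝ (coframe e i) := fun φ => by
    conv_lhs => rw [← show ∑ i, φ (e i) • coframe e i = φ from by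
      ext v
      simp only [LinearMap.sum_apply, LinearMap.smul_apply, coframe, innerₗ_apply_apply,
        smul_eq_mul]
      conv_rhs => rw [← e.sum_repr' v]
      simp [mul_comm]]
    simp
  rw [h φ, h ψ, Finset.sum_mul_sum]
  simp [framePair, smul_smul, mul_comm]

theorem degreeTwoPart_of_mem {θ : Forms V} (hθ : θ ∈ ⋀[ℝ]^2 (Module.Dual ℝ V)) :
    degreeTwoPart e θ = θ := by
  rw [← ExteriorAlgebra.ιMulti_span_fixedDegree] at hθ
  induction hθ using Submodule.span_induction with
  | zero => simp
  | add a b _ _ ha hb => rw [map_add, ha, hb]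
  | smul c a _ ha => rw [map_smul, ha]
  | mem a ha =>
    obtain ⟨φ, rfl⟩ := ha
    have h1 : ExteriorAlgebra.ιMulti ℝ 2 φ =
        ExteriorAlgebra.ι ℝ (φ 0) * ExteriorAlgebra.ι ℝ (φ 1) := by
      simp [ExteriorAlgebra.ιMulti_apply, Matrix.vecTail]
    have h2 : ∀ u v : V, evalForm ![u, v] (ExteriorAlgebra.ιMulti ℝ 2 φ) =
        φ 0 u * φ 1 v - φ 1 u * φ 0 v := fun u v => by
      rw [evalForm_ιMulti, Matrix.det_fin_two]
      simp [mul_comm]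
    have h3 := eq_neg_of_add_eq_zero_left (ExteriorAlgebra.ι_add_mul_swap (R := ℝ) (φ 1) (φ 0))
    simp only [degreeTwoPart, LinearMap.smul_apply, LinearMap.sum_apply,
      LinearMap.smulRight_apply, h2]
    simp only [ sub_smul, Finset.sum_sub_distrib, ι_mul_ι_eq_sum, h3, h1]
    module

theorem map_degreeTwoPart (ω : DoubleForm V) :
    TensorProduct.map (degreeTwoPart e) (degreeTwoPart e) ω =
      (4⁻¹ : ℝ) • ∑ i, ∑ j, ∑ k, ∑ l, eval ![e i, e j] ![e k, e l] ω •
        (framePair e i j ⊗ₜ[ℝ] framePair e k l) := by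
  induction ω using TensorProduct.induction_on with
  | zero => simp
  | add a b ha hb =>
    rw [map_add, ha, hb]
    simp only [map_add, add_smul, Finset.sum_add_distrib, smul_add]
  | tmul a b =>
    simp only [TensorProduct.map_tmul, degreeTwoPart, LinearMap.smul_apply, LinearMap.sum_apply,
      LinearMap.smulRight_apply, TensorProduct.tmul_smul, ← TensorProduct.smul_tmul',
      TensorProduct.sum_tmul]
    simp only [TensorProduct.tmul_smul, TensorProduct.tmul_sum, smul_smul, Finset.smul_sum, eval,
      LinearMap.comp_apply, TensorProduct.map_tmul, LinearMap.mul'_apply]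
    refine Finset.sum_congr rfl fun i _ => Finset.sum_congr rfl fun j _ =>
      Finset.sum_congr rfl fun k _ => Finset.sum_congr rfl fun l _ => ?_
    congr 1
    ring

theorem eq_sum_framePair {R : DoubleForm V} (hR : R ∈ bidegree V 2 2) :
    R = (4⁻¹ : ℝ) • ∑ i, ∑ j, ∑ k, ∑ l, eval ![e i, e j] ![e k, e l] R •
        (framePair e i j ⊗ₜ[ℝ] framePair e k l) := by
  rw [← map_degreeTwoPart]
  obtain ⟨t, rfl⟩ := hR
  have h : degreeTwoPart e ∘ₗ (⋀[ℝ]^2 (Module.Dual ℝ V)).subtype =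
      (⋀[ℝ]^2 (Module.Dual ℝ V)).subtype :=
    LinearMap.ext fun θ => degreeTwoPart_of_mem e θ.2
  rw [← LinearMap.comp_apply, ← TensorProduct.map_comp, h]

theorem eval_cyclic_sum {R : DoubleForm V} (hB : FirstBianchi 2 1 R) (x y z w : V) :
    eval ![x, y] ![z, w] R + eval ![y, z] ![x, w] R + eval ![z, x] ![y, w] R = 0 := by
  have h := hB ![x, y, z] ![w]
  have h0 : ∀ j : Fin 3, ∀ u v s : V, (∀ i, ![x, y, z] (j.succAbove i) = ![u, v] i) →
      ![x, y, z] j = s →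
      eval (fun i => ![x, y, z] (j.succAbove i))
        (Fin.cons (![x, y, z] j) ![w] : Fin 2 → V) R = eval ![u, v] ![s, w] R := by
    rintro j u v s h1 rfl
    rw [funext h1]
    rfl
  rw [Fin.sum_univ_three, h0 0 y z x (by intro i; fin_cases i <;> rfl) rfl,
    h0 1 x z y (by intro i; fin_cases i <;> rfl) rfl,
    h0 2 x y z (by intro i; fin_cases i <;> rfl) rfl] at h
  rw [eval_pair_swap x z]
  simp at h
  linarith

/-- An algebraic curvature tensor is a combination of products of squares of covectors. -/
theorem mem_symm11_pow_two (e : OrthonormalBasis (Fin n) ℝ V) {R : DoubleForm V}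
    (hR : R ∈ bidegree V 2 2) (hS : IsSymmetric R) (hB : FirstBianchi 2 1 R) : R ∈ symm11 V ^ 2 := by
  obtain ⟨r, hr⟩ : ∃ r : Fin n → Fin n → Fin n → Fin n → ℝ,
      r = fun i j k l => eval ![e i, e j] ![e k, e l] R := ⟨_, rfl⟩
  have hexp : R = (4⁻¹ : ℝ) • ∑ i, ∑ j, ∑ k, ∑ l, r i j k l •
      (framePair e i j ⊗ₜ[ℝ] framePair e k l) := by
    rw [hr]; exact eq_sum_framePair e hR
  have hexp' : R = (4⁻¹ : ℝ) • ∑ i, ∑ j, ∑ k, ∑ l, r i j k l •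
      (framePair e k l ⊗ₜ[ℝ] framePair e i j) := by
    have h := congrArg transpose hexp
    rw [hS] at h
    simpa [transpose] using h
  set S : Fin n → Fin n → Fin n → Fin n → DoubleForm V := fun i j k l =>
    symmProd (coframe e i) (coframe e j) (coframe e k) (coframe e l)
  -- The `8` is `4 + 4`: the ordered index pairs in the expansion of `R` count it four times, and
  -- each half of `S` contributes one such expansion by symmetry of `R`.
  have h8 : R = (8⁻¹ : ℝ) • ∑ i, ∑ j, ∑ k, ∑ l, r i j k l • S i j k l := by
    have h : ∑ i, ∑ j, ∑ k, ∑ l, r i j k l • S i j k l = (4 : ℝ) • R + (4 : ℝ) • R := by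
      conv_rhs =>
        congr
        · rw [hexp]
        · rw [hexp']
      rw [smul_smul, smul_smul]
      norm_num
      simp only [← Finset.sum_add_distrib, ← smul_add]
      rfl
    rw [h]
    module
  -- Reindexing moves the cyclic sum from `S` to the coefficients, where the Bianchi identity kills
  -- it.
  have hcyc : ∑ i, ∑ j, ∑ k, ∑ l, r i j k l • (S i j k l + S j k i l + S k i j l) = 0 := by
    have e1 : ∑ i, ∑ j, ∑ k, ∑ l, r i j k l • S j k i l =
        ∑ i, ∑ j, ∑ k, ∑ l, r k i j l • S i j k l := by
      rw [Finset.sum_comm]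
      exact Finset.sum_congr rfl fun j _ => Finset.sum_comm
    have e2 : ∑ i, ∑ j, ∑ k, ∑ l, r i j k l • S k i j l =
        ∑ i, ∑ j, ∑ k, ∑ l, r j k i l • S i j k l := by
      rw [Finset.sum_congr rfl fun i _ => Finset.sum_comm, Finset.sum_comm]
    simp only [smul_add, Finset.sum_add_distrib]
    rw [e1, e2]
    simp only [← Finset.sum_add_distrib, ← add_smul]
    refine Finset.sum_eq_zero fun i _ => Finset.sum_eq_zero fun j _ =>
      Finset.sum_eq_zero fun k _ => Finset.sum_eq_zero fun l _ => ?_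
    have := eval_cyclic_sum hB (e i) (e j) (e k) (e l)
    rw [show r i j k l + r k i j l + r j k i l = 0 by rw [hr]; dsimp only; linarith, zero_smul]
  -- Subtracting the vanishing cyclic sum changes nothing, but places every summand in `symm11 V ^
  -- 2`.
  have h24 : R = (24⁻¹ : ℝ) • ∑ i, ∑ j, ∑ k, ∑ l,
      r i j k l • ((3 : ℝ) • S i j k l - (S i j k l + S j k i l + S k i j l)) := by
    simp only [smul_sub (r _ _ _ _), Finset.sum_sub_distrib]
    rw [hcyc, sub_zero]
    simp only [smul_comm _ (3 : ℝ), ← Finset.smul_sum]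
    conv_lhs => rw [h8]
    rw [smul_smul]
    norm_num
  rw [h24]
  exact Submodule.smul_mem _ _ <| sum_mem fun i _ => sum_mem fun j _ => sum_mem fun k _ =>
    sum_mem fun l _ => Submodule.smul_mem _ _ (three_symmProd_sub_mem _ _ _ _)

end Euclidean

/-! ### Induction on products of squares -/

section Span

variable {V : Type*} [AddCommGroup V] [Module ℝ V]

theorem one_mem_symm11_pow_zero : (1 : DoubleForm V) ∈ symm11 V ^ 0 := by
  rw [pow_zero, Submodule.mem_one]
  exact ⟨1, map_one _⟩

theorem sq_mul_mem {p : ℕ} (φ : Module.Dual ℝ V) {ω : DoubleForm V} (hω : ω ∈ symm11 V ^ p) :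
    sq φ * ω ∈ symm11 V ^ (p + 1) := by
  rw [pow_succ']
  exact Submodule.mul_mem_mul (sq_mem_symm11 φ) hω

theorem symm11_pow_induction {C : (p : ℕ) → (ω : DoubleForm V) → ω ∈ symm11 V ^ p → Prop}
    (one : C 0 1 one_mem_symm11_pow_zero)
    (add : ∀ p x y hx hy, C p x hx → C p y hy → C p (x + y) (add_mem hx hy))
    (smul : ∀ p (c : ℝ) x hx, C p x hx → C p (c • x) (Submodule.smul_mem _ c hx))
    (sq_mul : ∀ p φ x hx, C p x hx → C (p + 1) (sq φ * x) (sq_mul_mem φ hx))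
    {p : ℕ} {ω : DoubleForm V} (hω : ω ∈ symm11 V ^ p) : C p ω hω := by
  suffices h : ∃ h, C p ω h from h.2
  induction p generalizing ω with
  | zero =>
    have h := hω
    rw [pow_zero, Submodule.mem_one] at h
    obtain ⟨c, rfl⟩ := h
    rw [Algebra.algebraMap_eq_smul_one]
    exact ⟨_, smul _ _ _ _ one⟩
  | succ p ih =>
    rw [pow_succ'] at hω
    induction hω using Submodule.mul_induction_on' with
    | add x _ y _ hx hy => exact ⟨_, add _ _ _ _ _ hx.2 hy.2⟩
    | mem_mul_mem m hm x hx =>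
      induction hm using Submodule.span_induction with
      | mem m hm =>
        obtain ⟨φ, rfl⟩ := hm
        exact ⟨_, sq_mul p φ x hx (ih hx).2⟩
      | zero =>
        -- The principle has no clause for zero, so zero is produced as a scalar multiple of a
        -- genuine product in degree `p + 1`.
        rw [show (0 : DoubleForm V) * x = (0 : ℝ) • (sq 0 * x) by rw [zero_mul, zero_smul]]
        exact ⟨_, smul _ _ _ _ (sq_mul p 0 x hx (ih hx).2)⟩
      | add a b _ _ ha hb => rw [add_mul]; exact ⟨_, add _ _ _ _ _ ha.2 hb.2⟩
      | smul c a _ ha => rw [smul_mul_assoc]; exact ⟨_, smul _ _ _ _ ha.2⟩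

theorem sq_commute_of_mem {p : ℕ} (φ : Module.Dual ℝ V) {ω : DoubleForm V}
    (hω : ω ∈ symm11 V ^ p) : Commute (sq φ) ω := by
  induction hω using symm11_pow_induction with
  | one => exact Commute.one_right _
  | add p x y _ _ hx hy => exact hx.add_right hy
  | smul p c x _ hx => exact hx.smul_right c
  | sq_mul p ψ x _ hx => exact (sq_commute φ ψ).mul_right hx

end Span

/-! ### The contraction and the grading on products of squares -/

section Euclidean

variable {V : Type*} [NormedAddCommGroup V] [InnerProductSpace ℝ V] [FiniteDimensional ℝ V]
variable {n : ℕ} (e : OrthonormalBasis (Fin n) ℝ V)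

theorem weight_mem {p : ℕ} (φ : Module.Dual ℝ V) {ω : DoubleForm V} (hω : ω ∈ symm11 V ^ p) :
    weight φ ω ∈ symm11 V ^ p := by
  induction hω using symm11_pow_induction with
  | one =>
    rw [weight_one]
    exact Submodule.smul_mem _ _ one_mem_symm11_pow_zero
  | add p x y _ _ hx hy => rw [map_add]; exact add_mem hx hy
  | smul p c x _ hx => rw [map_smul]; exact Submodule.smul_mem _ _ hx
  | sq_mul p ψ x hx h =>
    rw [← mulSq_apply, ← Module.End.mul_apply, weight_mulSq]
    simp only [LinearMap.sub_apply, Module.End.mul_apply, LinearMap.smul_apply, mulSq_apply]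
    exact sub_mem (sq_mul_mem _ h) (Submodule.smul_mem _ _
      (sub_mem (sub_mem (sq_mul_mem _ hx) (sq_mul_mem _ hx)) (sq_mul_mem _ hx)))

theorem contraction_mem_and {p : ℕ} {ω : DoubleForm V} (hω : ω ∈ symm11 V ^ p) :
    (p = 0 → contraction e ω = 0) ∧ (∀ k, p = k + 1 → contraction e ω ∈ symm11 V ^ k) := by
  induction hω using symm11_pow_induction with
  | one => exact ⟨fun _ => contraction_one e, fun k hk => by omega⟩
  | add p x y _ _ hx hy =>
    exact ⟨fun h => by rw [map_add, hx.1 h, hy.1 h, add_zero],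
      fun k hk => by rw [map_add]; exact add_mem (hx.2 k hk) (hy.2 k hk)⟩
  | smul p c x _ hx =>
    exact ⟨fun h => by rw [map_smul, hx.1 h, smul_zero],
      fun k hk => by rw [map_smul]; exact Submodule.smul_mem _ _ (hx.2 k hk)⟩
  | sq_mul p φ x hx h =>
    refine ⟨fun h => by omega, fun k hk => ?_⟩
    obtain rfl : p = k := by omega
    rw [← mulSq_apply, ← Module.End.mul_apply, contraction_mulSq]
    simp only [LinearMap.add_apply, Module.End.mul_apply, mulSq_apply]
    refine add_mem ?_ (weight_mem _ hx)
    cases p with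
    | zero => rw [h.1 rfl, mul_zero]; exact zero_mem _
    | succ p => exact sq_mul_mem _ (h.2 p rfl)

theorem contraction_pow_eq_zero {p : ℕ} {ω : DoubleForm V} (hω : ω ∈ symm11 V ^ p) {r : ℕ}
    (hr : p < r) : (contraction e ^ r) ω = 0 := by
  induction r generalizing p ω with
  | zero => omega
  | succ r ih =>
    rw [pow_succ, Module.End.mul_apply]
    cases p with
    | zero => rw [(contraction_mem_and e hω).1 rfl, map_zero]
    | succ p => exact ih ((contraction_mem_and e hω).2 p rfl) (by omega)

/-- The commutator of the contraction with the multiplication by the metric. -/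
def degreeOp : Module.End ℝ (DoubleForm V) :=
  contraction e * mulMetric e - mulMetric e * contraction e

theorem dfInner_degreeOp (ω η : DoubleForm V) :
    dfInner (degreeOp e ω) η = dfInner ω (degreeOp e η) := by
  simp only [degreeOp, LinearMap.sub_apply, Module.End.mul_apply, map_sub, dfInner_contraction,
    dfInner_mulMetric]

/-- Eigenvectors of a self-adjoint operator for distinct eigenvalues are orthogonal. This replaces
the orthogonality of different bidegrees. -/
theorem dfInner_eq_zero_of_degreeOp {ω η : DoubleForm V} {a b : ℝ} (hω : degreeOp e ω = a • ω)
    (hη : degreeOp e η = b • η) (hab : a ≠ b) : dfInner ω η = 0 := by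
  have h := dfInner_degreeOp e ω η
  rw [hω, hη, map_smul, map_smul, LinearMap.smul_apply, smul_eq_mul, smul_eq_mul, ← sub_eq_zero,
    ← sub_mul] at h
  exact (mul_eq_zero.mp h).resolve_left (sub_ne_zero.mpr hab)

theorem degreeOp_mulSq (φ : Module.Dual ℝ V) :
    degreeOp e * mulSq φ = mulSq φ * degreeOp e - (2 : ℝ) • mulSq φ :=
  commutator_mul_raising (contraction_mulSq e φ) (mulMetric_mulSq e φ) (mulMetric_weight e φ)

theorem degreeOp_intSq (φ : Module.Dual ℝ V) :
    degreeOp e * intSq (sharp φ) = intSq (sharp φ) * degreeOp e + (2 : ℝ) • intSq (sharp φ) :=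
  commutator_mul_lowering (intSq_mulMetric e φ) (contraction_intSq e _) (contraction_weight e φ)

theorem degreeOp_contraction :
    degreeOp e * contraction e = contraction e * degreeOp e + (2 : ℝ) • contraction e := by
  have h : ∀ i, degreeOp e * intSq (e i) =
      intSq (e i) * degreeOp e + (2 : ℝ) • intSq (e i) := fun i => by
    rw [← sharp_coframe e i]; exact degreeOp_intSq e _
  rw [contraction_eq, Finset.mul_sum, Finset.sum_mul, Finset.smul_sum, ← Finset.sum_add_distrib]
  exact Finset.sum_congr rfl fun i _ => h i

theorem degreeOp_one : degreeOp e (1 : DoubleForm V) = (n : ℝ) • 1 := by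
  rw [degreeOp, LinearMap.sub_apply, Module.End.mul_apply, Module.End.mul_apply, contraction_one,
    map_zero, sub_zero, mulMetric, LinearMap.sum_apply, map_sum]
  have h : ∀ i, contraction e (mulSq (coframe e i) 1) = (1 : DoubleForm V) := fun i => by
    rw [← Module.End.mul_apply, contraction_mulSq, LinearMap.add_apply, Module.End.mul_apply,
      contraction_one, map_zero, zero_add, weight_one, sharp_coframe]
    simp [coframe]
  simp [h, Nat.cast_smul_eq_nsmul]

theorem degreeOp_of_mem {p : ℕ} {ω : DoubleForm V} (hω : ω ∈ symm11 V ^ p) :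
    degreeOp e ω = (n - 2 * p : ℝ) • ω := by
  induction hω using symm11_pow_induction with
  | one => rw [degreeOp_one]; simp
  | add p x y _ _ hx hy => rw [map_add, hx, hy, smul_add]
  | smul p c x _ hx => rw [map_smul, hx, smul_comm]
  | sq_mul p φ x _ hx =>
    rw [← mulSq_apply, ← Module.End.mul_apply, degreeOp_mulSq, LinearMap.sub_apply,
      Module.End.mul_apply, hx, map_smul, LinearMap.smul_apply]
    push_cast
    module

theorem degreeOp_contraction_pow {p : ℕ} {ω : DoubleForm V} (hω : ω ∈ symm11 V ^ p) (r : ℕ) :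
    degreeOp e ((contraction e ^ r) ω) = (n - 2 * p + 2 * r : ℝ) • (contraction e ^ r) ω := by
  induction r with
  | zero => simpa using degreeOp_of_mem e hω
  | succ r ih =>
    rw [pow_succ', Module.End.mul_apply, ← Module.End.mul_apply (degreeOp e),
      degreeOp_contraction, LinearMap.add_apply, Module.End.mul_apply, ih, map_smul,
      LinearMap.smul_apply]
    push_cast
    module

/-! ### Gauss–Bonnet curvatures as full contractions -/

theorem metric_pow_mem (k : ℕ) : metric e ^ k ∈ symm11 V ^ k :=
  Submodule.pow_mem_pow _ (sum_mem fun i _ => sq_mem_symm11 (coframe e i)) k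

/-- Commuting `c` past the factors of `g` one by one collects the eigenvalues `n - 2j` for `0 ≤ j ≤
k`, whose sum is `(k + 1)(n - k)`. -/
theorem contraction_metric_pow (k : ℕ) :
    contraction e (metric e ^ (k + 1)) = ((k + 1) * (n - k) : ℝ) • metric e ^ k := by
  have hH : ∀ ω, contraction e (mulMetric e ω) = mulMetric e (contraction e ω) + degreeOp e ω :=
    fun ω => by simp [degreeOp]
  induction k with
  | zero =>
    rw [pow_succ', ← mulMetric_apply, hH, pow_zero, contraction_one, degreeOp_one]
    simp
  | succ k ih =>
    rw [pow_succ', ← mulMetric_apply, hH, ih, degreeOp_of_mem e (metric_pow_mem e (k + 1)),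
      map_smul, mulMetric_apply, ← pow_succ']
    push_cast
    module

theorem contraction_pow_metric_pow (m j : ℕ) (h : j + m = n) :
    (j.factorial : ℝ) • (contraction e ^ m) (metric e ^ n) =
      (n.factorial * m.factorial : ℝ) • metric e ^ j := by
  induction m generalizing j with
  | zero => obtain rfl : j = n := h; simp
  | succ m ih =>
    have h1 := congrArg (contraction e) (ih (j + 1) (by omega))
    have h2 : (n : ℝ) - j = m + 1 := by rw [← h]; push_cast; ring
    rw [map_smul, map_smul, contraction_metric_pow, h2, ← Module.End.mul_apply, ← pow_succ',
      Nat.factorial_succ] at h1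
    have hj : (j + 1 : ℝ) ≠ 0 := by positivity
    refine smul_right_injective _ hj ?_
    simp only [smul_smul] at h1 ⊢
    push_cast [Nat.factorial_succ] at h1 ⊢
    rw [h1]
    congr 1
    ring

/-- By adjointness `g^{n-k}` becomes `c^{n-k}` acting on `vol ⊗ vol = g^n / n!`, which gives
`((n-k)! / k!) g^k`. This `g^k` then returns to the other side as `c^k`. -/
theorem dfInner_volSq_metric_pow_mul {k : ℕ} (hk : k ≤ n) (ζ : DoubleForm V) :
    (1 / ((n - k).factorial : ℝ)) * dfInner (volSq e) (metric e ^ (n - k) * ζ) =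
      (k.factorial : ℝ)⁻¹ * dfInner 1 ((contraction e ^ k) ζ) := by
  have hc := contraction_pow_metric_pow e (n - k) k (by omega)
  have h1 : (n.factorial : ℝ) * dfInner (volSq e) (metric e ^ (n - k) * ζ) =
      dfInner ((contraction e ^ (n - k)) (metric e ^ n)) ζ := by
    rw [dfInner_comm _ ζ, ← dfInner_mulMetric_pow, mulMetric_pow_apply, metric_pow_finrank,
      map_smul, smul_eq_mul, dfInner_comm]
  have h2 : dfInner (metric e ^ k) ζ = dfInner 1 ((contraction e ^ k) ζ) := by
    rw [← dfInner_mulMetric_pow, mulMetric_pow_apply, mul_one]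
  have h3 := congrArg (fun ω => dfInner ω ζ) hc
  simp only [map_smul, LinearMap.smul_apply, smul_eq_mul] at h3
  rw [← h1, h2] at h3
  have hn : (n.factorial : ℝ) ≠ 0 := by positivity
  have hk : (k.factorial : ℝ) ≠ 0 := by positivity
  have hnk : ((n - k).factorial : ℝ) ≠ 0 := by positivity
  field_simp
  apply mul_left_cancel₀ hn
  linarith

/-! ### The operator `e^g e^{-c}` and the two evaluations -/

/-- The operator `e^g e^{-c}` on double forms. -/
def weylOp (N : ℕ) : Module.End ℝ (DoubleForm V) := weyl N (mulMetric e) (contraction e)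

theorem weylOp_mulSq {N : ℕ} (hg : mulMetric e ^ N = 0) (hc : contraction e ^ N = 0)
    (φ : Module.Dual ℝ V) (ω : DoubleForm V) :
    weylOp e N (mulSq φ ω) = -intSq (sharp φ) (weylOp e N ω) :=
  LinearMap.congr_fun (weyl_mul (contraction_mulSq e φ) (contraction_weight e φ)
    (contraction_intSq e _) (mulMetric_mulSq e φ) (mulMetric_weight e φ) (intSq_mulMetric e φ)
    hg hc) ω

theorem dfInner_weylOp_mul {N : ℕ} (hg : mulMetric e ^ N = 0) (hc : contraction e ^ N = 0) {p : ℕ}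
    {ω : DoubleForm V} (hω : ω ∈ symm11 V ^ p) (α η : DoubleForm V) :
    dfInner α (weylOp e N (ω * η)) = (-1) ^ p * dfInner (ω * α) (weylOp e N η) := by
  induction hω using symm11_pow_induction generalizing α with
  | one => simp
  | add p x y _ _ hx hy =>
    rw [add_mul, map_add, map_add, hx, hy, add_mul, map_add, LinearMap.add_apply, mul_add]
  | smul p c x _ hx =>
    rw [smul_mul_assoc, map_smul, map_smul, hx, smul_mul_assoc, map_smul, LinearMap.smul_apply,
      smul_eq_mul, smul_eq_mul]
    ring
  | sq_mul p φ x hxm hx =>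
    -- The square crosses over onto `α`, so the induction hypothesis is used at `sq φ * α`;
    -- commutativity then puts `sq φ` back in front of `x`.
    rw [mul_assoc, ← mulSq_apply, weylOp_mulSq e hg hc, map_neg, ← dfInner_mulSq, hx, mulSq_apply,
      ← mul_assoc, ← (sq_commute_of_mem φ hxm).eq, pow_succ]
    ring

theorem dfInner_weylOp_eq_sum (N : ℕ) (α η : DoubleForm V) :
    dfInner α (weylOp e N η) = ∑ r ∈ Finset.range N, ∑ s ∈ Finset.range N,
      ((r.factorial : ℝ)⁻¹ * ((s.factorial : ℝ)⁻¹ * (-1) ^ s)) *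
        dfInner ((contraction e ^ r) α) ((contraction e ^ s) η) := by
  have hadj : ∀ r, ∀ x y : DoubleForm V,
      dfInner x ((mulMetric e ^ r) y) = dfInner ((contraction e ^ r) x) y := fun r x y => by
    rw [dfInner_comm, dfInner_mulMetric_pow, dfInner_comm]
  have hneg : ∀ s : ℕ, ((-contraction e) ^ s) η = ((-1 : ℝ) ^ s) • (contraction e ^ s) η :=
    fun s => by
      rw [← neg_one_smul ℝ (contraction e), smul_pow, LinearMap.smul_apply]
  simp only [weylOp, weyl, truncExp, Module.End.mul_apply, LinearMap.sum_apply, LinearMap.smul_apply,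
    map_sum, map_smul, smul_eq_mul, hadj, hneg, Finset.mul_sum]
  rw [Finset.sum_comm]
  refine Finset.sum_congr rfl fun r _ => Finset.sum_congr rfl fun s _ => ?_
  ring

/-- Since `c 1 = 0`, only `r = 0` remains in the double sum; comparing the eigenvalues `n` and `n -
2k + 2s` leaves only `s = k`. -/
theorem dfInner_one_weylOp {N k : ℕ} (hN : k < N) {ζ : DoubleForm V} (hζ : ζ ∈ symm11 V ^ k) :
    dfInner 1 (weylOp e N ζ) =
      (-1) ^ k * ((k.factorial : ℝ)⁻¹ * dfInner 1 ((contraction e ^ k) ζ)) := by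
  rw [dfInner_weylOp_eq_sum, Finset.sum_eq_single 0, Finset.sum_eq_single k]
  · simp; ring
  · intro s _ hs
    rw [dfInner_eq_zero_of_degreeOp e (ω := (contraction e ^ 0) 1) (a := n)
      (by simpa using degreeOp_one e) (degreeOp_contraction_pow e hζ s), mul_zero]
    intro h
    apply hs
    have : (s : ℝ) = k := by linarith
    exact_mod_cast this
  · intro h; simp at h; omega
  · intro r _ hr
    refine Finset.sum_eq_zero fun s _ => ?_
    rw [contraction_pow_eq_zero e one_mem_symm11_pow_zero
      (Nat.pos_of_ne_zero hr)]
    simp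
  · intro h; simp at h; omega

/-- The forms `c^r ω` have distinct eigenvalues, so the double sum is diagonal, and it stops at `r =
p` because a further contraction vanishes. -/
theorem dfInner_weylOp_self {N p : ℕ} (hN : p < N) {ω : DoubleForm V} (hω : ω ∈ symm11 V ^ p) :
    dfInner ω (weylOp e N ω) = ∑ r ∈ Finset.range (p + 1),
      (-1 : ℝ) ^ r / (r.factorial : ℝ) ^ 2 * normSq ((contraction e ^ r) ω) := by
  rw [dfInner_weylOp_eq_sum, ← Finset.sum_subset (Finset.range_mono hN)]
  · refine Finset.sum_congr rfl fun r hr => ?_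
    rw [Finset.sum_eq_single r]
    · rw [normSq]
      field_simp
    · intro s _ hs
      rw [dfInner_eq_zero_of_degreeOp e (degreeOp_contraction_pow e hω r)
        (degreeOp_contraction_pow e hω s), mul_zero]
      intro h
      apply hs
      have : (s : ℝ) = r := by linarith
      exact_mod_cast this
    · intro h; simp at h hr; omega
  · intro r _ hr
    refine Finset.sum_eq_zero fun s _ => ?_
    rw [contraction_pow_eq_zero e hω (by simp at hr; omega)]
    simp

theorem gaussBonnet_eq {k : ℕ} (hk : 2 * k ≤ n) (R : DoubleForm V) :
    gaussBonnet e k R =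
      ((2 * k).factorial : ℝ)⁻¹ * dfInner 1 ((contraction e ^ (2 * k)) (R ^ k)) := by
  rw [gaussBonnet, eval_elim0_doubleHodge, dfInner_volSq_metric_pow_mul e hk]

theorem gaussBonnet_two_mul {R : DoubleForm V} (hR : R ∈ symm11 V ^ 2) {q : ℕ} (hq : 4 * q ≤ n) :
    gaussBonnet e (2 * q) R = ∑ r ∈ Finset.range (2 * q + 1),
      (-1 : ℝ) ^ r / (r.factorial : ℝ) ^ 2 * normSq ((contraction e ^ r) (R ^ q)) := by
  obtain ⟨N₁, hg⟩ := isNilpotent_mulMetric e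
  obtain ⟨N₂, hc⟩ := isNilpotent_contraction e
  -- Large enough for both truncated exponentials to be complete and for every index up to `4q` to
  -- occur in the sums.
  set N := N₁ + N₂ + 4 * q + 1
  have hg' : mulMetric e ^ N = 0 := pow_eq_zero_of_le (by omega) hg
  have hc' : contraction e ^ N = 0 := pow_eq_zero_of_le (by omega) hc
  have hω : R ^ q ∈ symm11 V ^ (2 * q) := by
    rw [pow_mul]; exact Submodule.pow_mem_pow _ hR q
  have hζ : R ^ (2 * q) ∈ symm11 V ^ (2 * (2 * q)) := by
    rw [pow_mul _ 2]; exact Submodule.pow_mem_pow _ hR _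
  have h1 := dfInner_one_weylOp e (N := N) (by omega) hζ
  have h2 := dfInner_weylOp_mul e hg' hc' hω 1 (R ^ q)
  rw [← pow_add, ← two_mul, mul_one] at h2
  rw [gaussBonnet_eq e (by omega), ← dfInner_weylOp_self e (N := N) (by omega) hω]
  -- The two signs are `(-1)^{2q}`, from moving `R^q` across, and `(-1)^{4q}`, from `e^{-c}`.
  rw [h2, Even.neg_one_pow (by simp), Even.neg_one_pow (by simp), one_mul, one_mul] at h1
  exact h1.symm

end Euclidean

end DoubleForms

end

theorem mainTheorem8 {V : Type*} [NormedAddCommGroup V] [InnerProductSpace ℝ V]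
    [FiniteDimensional ℝ V] {n : ℕ} (e : OrthonormalBasis (Fin n) ℝ V)
    (R : DoubleForms.DoubleForm V) (hR : R ∈ DoubleForms.bidegree V 2 2)
    (hsymm : DoubleForms.IsSymmetric R) (hBianchi : DoubleForms.FirstBianchi 2 1 R) :
    (∀ q : ℕ, 0 < q → 4 * q ≤ n →
      DoubleForms.gaussBonnet e (2 * q) R =
        ∑ r ∈ Finset.range (2 * q + 1), (-1 : ℝ) ^ r / (r.factorial : ℝ) ^ 2 *
          DoubleForms.normSq ((DoubleForms.contraction e ^ r) (R ^ q))) ∧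
    (4 ≤ n →
      DoubleForms.gaussBonnet e 2 R =
        DoubleForms.normSq R - DoubleForms.normSq (DoubleForms.contraction e R) +
          1 / 4 * DoubleForms.normSq ((DoubleForms.contraction e ^ 2) R)) ∧
    (8 ≤ n →
      DoubleForms.gaussBonnet e 4 R =
        DoubleForms.normSq (R ^ 2) - DoubleForms.normSq (DoubleForms.contraction e (R ^ 2)) +
          1 / 4 * DoubleForms.normSq ((DoubleForms.contraction e ^ 2) (R ^ 2)) -
          1 / 36 * DoubleForms.normSq ((DoubleForms.contraction e ^ 3) (R ^ 2)) +
          1 / 576 * DoubleForms.normSq ((DoubleForms.contraction e ^ 4) (R ^ 2))) := by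
  have hmem := DoubleForms.mem_symm11_pow_two e hR hsymm hBianchi
  refine ⟨fun q _ hq => DoubleForms.gaussBonnet_two_mul e hmem hq, fun hn => ?_, fun hn => ?_⟩
  · have h := DoubleForms.gaussBonnet_two_mul e hmem (q := 1) (by omega)
    simp only [mul_one, pow_one] at h
    rw [h]
    simp [Finset.sum_range_succ, Nat.factorial]
    ring
  · have h := DoubleForms.gaussBonnet_two_mul e hmem (q := 2) (by omega)
    norm_num only at h
    rw [h]
    simp [Finset.sum_range_succ, Nat.factorial]
    ring
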